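/- All $C^*$-algebras are complex and not necessarily unital. A $C^*$-correspondence $(X,A)$ consists of a $C^*$-algebra $A$, a right Hilbert $A$-module $X$ (a Banach space with a right $A$-action and an $A$-valued inner product, linear in the second variable, satisfying $\langle\xi,\eta a\rangle=\langle\xi,\eta\rangle a$, $\langle\eta,\xi\rangle=\langle\xi,\eta\rangle^*$, $\langle\xi,\xi\rangle\ge 0$ and $\|\xi\|=\|\langle\xi,\xi\rangle\|^{1/2}$), and a $*$-homomorphism $\phi_X:A\to\mathcal L(X)$ into the adjointable operators. Let $\theta_{\xi,\eta}(\zeta)=\xi\langle\eta,\zeta\rangle$, let $\mathcal K(X)=\overline{\operatorname{span}}\{\theta_{\xi,\eta}:\xi,\eta\in X\}$, and let $J_X=\{a\in A:\phi_X(a)\in\mathcal K(X)\text{ and }ab=0\text{ for all }b\in\ker\phi_X\}$. A morphism $(X,A)\to(Y,B)$ is a pair $(\psi_X,\psi_A)$ of a linear map $\psi_X:X\to Y$ and a $*$-homomorphism $\psi_A:A\to B$ such that (C1) $\langle\psi_X(\xi),\psi_X(\eta)\rangle=\psi_A(\langle\xi,\eta\rangle)$ for all $\xi,\eta\in X$;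 (C2) $\psi_X(\phi_X(a)\xi)=\phi_Y(\psi_A(a))\psi_X(\xi)$ for all $a\in A$, $\xi\in X$; (C3) $\psi_A(J_X)\subset J_Y$; (C4) $\phi_Y(\psi_A(a))=\psi_X^+(\phi_X(a))$ for all $a\in J_X$, where $\psi_X^+:\mathcal K(X)\to\mathcal K(Y)$ is the continuous linear map with $\psi_X^+(\theta_{\xi,\eta})=\theta_{\psi_X(\xi),\psi_X(\eta)}$, which exists (because of (C1)) and is unique. For a $C^*$-algebra $D$, regard $(D,D)$ as a $C^*$-correspondence with both actions given by multiplication and $\langle a,b\rangle=a^*b$. A covariant representation of $(X,A)$ on $D$ is a morphism $(X,A)\to(D,D)$. Let $\mathcal O_X$ be the $C^*$-algebra generated by the image of $(X,A)$ under the direct sum $(\pi_X,\pi_A)$ of all covariant representations of $(X,A)$ (on $C^*$-algebras in a fixed universe). Then: 1. Identity pairs $(\mathrm{id}_X,\mathrm{id}_A)$ are morphisms and compositions of morphisms are morphisms, so $C^*$-correspondences and their morphisms form a category. 2. $(\pi_X,\pi_A)$ is a universal covariant representation of $(X,A)$ on $\mathcal O_X$: it is a covariant representation, its image generates $\mathcal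 O_X$ as a $C^*$-algebra, and for every covariant representation $(\rho_X,\rho_A)$ of $(X,A)$ on a $C^*$-algebra $D$ there is a unique $*$-homomorphism $\Phi:\mathcal O_X\to D$ with $\Phi\circ\pi_X=\rho_X$ and $\Phi\circ\pi_A=\rho_A$. 3. For every morphism $(\psi_X,\psi_A):(X,A)\to(Y,B)$ there is a unique $*$-homomorphism $\Psi:\mathcal O_X\to\mathcal O_Y$ with $\Psi\circ\pi_X=\pi_Y\circ\psi_X$ and $\Psi\circ\pi_A=\pi_B\circ\psi_A$. 4. There is a unique covariant functor $F$ from the category of $C^*$-correspondences to the category of $C^*$-algebras and $*$-homomorphisms such that $F(X,A)=\mathcal O_X$ for every $(X,A)$ and, for every morphism $(\psi_X,\psi_A)$, $F(\psi_X,\psi_A)$ satisfies the two identities required of $\Psi$ in 3. -/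

import Mathlib

universe u

/-- A `C⋆`-correspondence `(X, A)`: a (complex, not necessarily unital) `C⋆`-algebra `A`, a right
Hilbert `A`-module `X`, and a `⋆`-homomorphism `φ` from `A` to the adjointable operators of `X`. -/
structure CStarCorr : Type (u + 1) where
  /-- the coefficient algebra -/
  A : Type u
  /-- the Hilbert module -/
  X : Type u
  [algA : NonUnitalCStarAlgebra A]
  [normX : NormedAddCommGroup X]
  [spaceX : NormedSpace ℂ X]
  [completeX : CompleteSpace X]
  /-- the right action `ξ ↦ ξ a` -/
  act : X →ₗ[ℂ] A →ₗ[ℂ] X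
  act_mul : ∀ (ξ : X) (a b : A), act ξ (a * b) = act (act ξ a) b
  /-- the `A`-valued inner product, linear in the second variable -/
  inner : X → X →ₗ[ℂ] A
  inner_act : ∀ (ξ η : X) (a : A), inner ξ (act η a) = inner ξ η * a
  star_inner : ∀ ξ η : X, star (inner ξ η) = inner η ξ
  /-- positivity of `⟨ξ, ξ⟩` in the `C⋆`-algebra `A` -/
  inner_self_pos : ∀ ξ : X, ∃ b : A, inner ξ ξ = star b * b
  norm_eq : ∀ ξ : X, ‖ξ‖ = √‖inner ξ ξ‖
  /-- the left action; an algebra homomorphism into the bounded operators on `X` … -/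
  φ : A →ₙₐ[ℂ] (X →L[ℂ] X)
  /-- … such that `φ (star a)` is the adjoint of `φ a`: thus every `φ a` is adjointable and `φ` is
  a `⋆`-homomorphism into the `C⋆`-algebra of adjointable operators. -/
  φ_adjoint : ∀ (a : A) (ξ η : X), inner (φ a ξ) η = inner ξ (φ (star a) η)

namespace CStarCorr

attribute [instance] algA normX spaceX completeX

section Basic

variable (E : CStarCorr.{u})

theorem inner_add_left (ξ η ζ : E.X) : E.inner (ξ + η) ζ = E.inner ξ ζ + E.inner η ζ := by
  rw [← E.star_inner, map_add, star_add, E.star_inner, E.star_inner]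

theorem inner_smul_left (c : ℂ) (ξ ζ : E.X) : E.inner (c • ξ) ζ = star c • E.inner ξ ζ := by
  rw [← E.star_inner, map_smul, star_smul, E.star_inner]

theorem inner_sub_left (ξ η ζ : E.X) : E.inner (ξ - η) ζ = E.inner ξ ζ - E.inner η ζ := by
  rw [← E.star_inner, map_sub, star_sub, E.star_inner, E.star_inner]

theorem inner_act_left (ξ η : E.X) (a : E.A) :
    E.inner (E.act ξ a) η = star a * E.inner ξ η := by
  rw [← E.star_inner, E.inner_act, star_mul, E.star_inner]

theorem norm_sq (ξ : E.X) : ‖ξ‖ ^ 2 = ‖E.inner ξ ξ‖ := by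
  rw [E.norm_eq, Real.sq_sqrt (norm_nonneg _)]

theorem inner_self_eq_zero {ξ : E.X} (h : E.inner ξ ξ = 0) : ξ = 0 := by
  have := E.norm_sq ξ
  rw [h, norm_zero] at this
  exact norm_eq_zero.1 (pow_eq_zero_iff two_ne_zero |>.1 this)

theorem ext_inner {ξ η : E.X} (h : ∀ ζ, E.inner ζ ξ = E.inner ζ η) : ξ = η := by
  rw [← sub_eq_zero]
  apply E.inner_self_eq_zero
  rw [map_sub, h, sub_self]

/-- The Cauchy–Schwarz inequality. -/
theorem norm_inner_le (ξ η : E.X) : ‖E.inner ξ η‖ ≤ ‖ξ‖ * ‖η‖ := by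
  let _ : PartialOrder E.A := CStarAlgebra.spectralOrder E.A
  have : StarOrderedRing E.A := CStarAlgebra.spectralOrderedRing E.A
  have pos : ∀ ζ : E.X, 0 ≤ E.inner ζ ζ := fun ζ => by
    obtain ⟨b, hb⟩ := E.inner_self_pos ζ
    rw [hb]; exact star_mul_self_nonneg b
  rcases eq_or_ne ξ 0 with rfl | h0
  · rw [← E.star_inner, map_zero, star_zero]; simp
  have hr : 0 < ‖ξ‖ ^ 2 := by positivity
  set r : ℝ := ‖ξ‖ ^ 2 with hr_def
  set a : E.A := E.inner ξ η with ha
  have hsa : E.inner η ξ = star a := by rw [ha, E.star_inner]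
  have h1 : 0 ≤ E.inner (E.act ξ a - (r : ℂ) • η) (E.act ξ a - (r : ℂ) • η) := pos _
  have h2 : E.inner (E.act ξ a - (r : ℂ) • η) (E.act ξ a - (r : ℂ) • η)
      = star a * E.inner ξ ξ * a - (r • (star a * a)) - (r • (star a * a))
        + r • (r • E.inner η η) := by
    have hc : ∀ d : E.A, r • d = (r : ℂ) • d := fun d => (Complex.coe_smul r d).symm
    simp only [map_sub, map_smul, E.inner_sub_left, E.inner_smul_left, E.inner_act,
      E.inner_act_left, hsa, ← ha, smul_sub, mul_smul_comm, Complex.star_def,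
      Complex.conj_ofReal, hc, mul_sub, mul_assoc]
    abel
  have h3 : star a * E.inner ξ ξ * a ≤ r • (star a * a) := by
    rw [hr_def, E.norm_sq]
    exact CStarAlgebra.star_left_conjugate_le_norm_smul (E.star_inner ξ ξ)
  have h4 : star a * a ≤ r • E.inner η η := by
    rw [h2] at h1
    have h5 : 0 ≤ r • (r • E.inner η η) - r • (star a * a) := by
      refine h1.trans ?_
      have := sub_nonneg.2 h3
      rw [← sub_nonneg]
      refine this.trans (le_of_eq ?_)
      abel
    rw [← smul_sub] at h5
    have h6 := smul_nonneg (inv_nonneg.2 hr.le) h5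
    rwa [inv_smul_smul₀ hr.ne', sub_nonneg] at h6
  have h5 : ‖a‖ * ‖a‖ ≤ ‖ξ‖ ^ 2 * ‖η‖ ^ 2 := by
    rw [← CStarRing.norm_star_mul_self]
    refine (CStarAlgebra.norm_le_norm_of_nonneg_of_le (star_mul_self_nonneg a) h4).trans ?_
    rw [norm_smul, E.norm_sq η, Real.norm_of_nonneg hr.le]
  refine le_of_sq_le_sq ?_ (by positivity)
  nlinarith

theorem norm_act_le (ξ : E.X) (a : E.A) : ‖E.act ξ a‖ ≤ ‖ξ‖ * ‖a‖ := by
  refine le_of_sq_le_sq ?_ (by positivity)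
  rw [E.norm_sq, E.inner_act, E.inner_act_left, mul_pow, E.norm_sq ξ]
  calc ‖star a * E.inner ξ ξ * a‖ ≤ ‖star a‖ * ‖E.inner ξ ξ‖ * ‖a‖ :=
        (norm_mul_le _ _).trans (by gcongr; exact norm_mul_le _ _)
    _ = ‖E.inner ξ ξ‖ * ‖a‖ ^ 2 := by rw [norm_star]; ring

/-- The rank-one operator `θ_{ξ,η} ζ = ξ ⟨η, ζ⟩`. -/
noncomputable def theta (ξ η : E.X) : E.X →L[ℂ] E.X :=
  ((E.act ξ).comp (E.inner η)).mkContinuous (‖ξ‖ * ‖η‖) fun ζ => by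
    refine (E.norm_act_le _ _).trans ?_
    rw [mul_assoc]
    gcongr
    exact E.norm_inner_le _ _

@[simp]
theorem theta_apply (ξ η ζ : E.X) : E.theta ξ η ζ = E.act ξ (E.inner η ζ) := rfl

theorem norm_theta_le (ξ η : E.X) : ‖E.theta ξ η‖ ≤ ‖ξ‖ * ‖η‖ :=
  LinearMap.mkContinuous_norm_le _ (by positivity) _

/-- The compact operators of the Hilbert module `X`: the closed linear span of the rank-one
operators `θ_{ξ,η}`, with respect to the operator norm. -/
noncomputable def compacts : Submodule ℂ (E.X →L[ℂ] E.X) :=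
  (Submodule.span ℂ {T | ∃ ξ η : E.X, T = E.theta ξ η}).topologicalClosure

theorem theta_mem (ξ η : E.X) : E.theta ξ η ∈ E.compacts :=
  Submodule.le_topologicalClosure _ (Submodule.subset_span ⟨ξ, η, rfl⟩)

/-- Katsura's ideal `J_X = {a ∈ A : φ a is compact and a b = 0 for all b ∈ ker φ}`. -/
def katsuraIdeal : Set E.A :=
  {a | E.φ a ∈ E.compacts ∧ ∀ b : E.A, E.φ b = 0 → a * b = 0}

/-- Continuous linear maps on the compact operators are determined by their values on the
rank-one operators. -/
theorem compacts_ext {V : Type*} [AddCommMonoid V] [Module ℂ V] [TopologicalSpace V] [T2Space V]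
    (P Q : E.compacts →L[ℂ] V)
    (h : ∀ ξ η, P ⟨E.theta ξ η, E.theta_mem ξ η⟩ = Q ⟨E.theta ξ η, E.theta_mem ξ η⟩) :
    P = Q := by
  let S : Submodule ℂ (E.X →L[ℂ] E.X) := Submodule.span ℂ {T | ∃ ξ η : E.X, T = E.theta ξ η}
  have hS : S ≤ E.compacts := Submodule.le_topologicalClosure _
  have key : ∀ T (hT : T ∈ S), P ⟨T, hS hT⟩ = Q ⟨T, hS hT⟩ := by
    intro T hT
    induction hT using Submodule.span_induction with
    | mem T hT => obtain ⟨ξ, η, rfl⟩ := hT; exact h ξ η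
    | zero => exact (map_zero P).trans (map_zero Q).symm
    | add T U hT hU h1 h2 =>
      have e : (⟨T + U, hS (S.add_mem hT hU)⟩ : E.compacts) = ⟨T, hS hT⟩ + ⟨U, hS hU⟩ := rfl
      exact (congrArg P e).trans (by rw [map_add, h1, h2, ← map_add]; rfl)
    | smul c T hT h1 =>
      have e : (⟨c • T, hS (S.smul_mem c hT)⟩ : E.compacts) = c • ⟨T, hS hT⟩ := rfl
      exact (congrArg P e).trans (by rw [map_smul, h1, ← map_smul]; rfl)
  ext ⟨T, hT⟩
  have hT' : T ∈ closure (S : Set (E.X →L[ℂ] E.X)) := hT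
  obtain ⟨s, hs, hlim⟩ := mem_closure_iff_seq_limit.1 hT'
  have hlim' : Filter.Tendsto (fun n => (⟨s n, hS (hs n)⟩ : E.compacts)) Filter.atTop
      (nhds ⟨T, hT⟩) := tendsto_subtype_rng.2 hlim
  have h1 := (P.continuous.tendsto _).comp hlim'
  have h2 := (Q.continuous.tendsto _).comp hlim'
  refine tendsto_nhds_unique h1 (h2.congr fun n => ?_)
  exact (key _ (hs n)).symm

end Basic

section Plus

/-- `T` and `T'` are adjoint to each other. -/
def AdjointPair (E : CStarCorr.{u}) (T T' : E.X →L[ℂ] E.X) : Prop :=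
  ∀ ξ η, E.inner (T ξ) η = E.inner ξ (T' η)

namespace AdjointPair

variable {E : CStarCorr.{u}} {T T' S S' : E.X →L[ℂ] E.X}

theorem symm (h : E.AdjointPair T T') : E.AdjointPair T' T := fun ξ η => by
  rw [← E.star_inner, ← h, E.star_inner]

theorem mul (h : E.AdjointPair T T') (k : E.AdjointPair S S') :
    E.AdjointPair (T * S) (S' * T') := fun ξ η => by
  simp only [mul_apply_eq_comp]
  rw [h, k]

theorem add (h : E.AdjointPair T T') (k : E.AdjointPair S S') :
    E.AdjointPair (T + S) (T' + S') := fun ξ η => by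
  simp only [add_apply, map_add]
  rw [E.inner_add_left, h, k]

theorem smul (c : ℂ) (h : E.AdjointPair T T') : E.AdjointPair (c • T) (star c • T') := fun ξ η => by
  simp only [smul_apply, map_smul]
  rw [E.inner_smul_left, h]

theorem pow (h : E.AdjointPair T T) (n : ℕ) : E.AdjointPair (T ^ n) (T ^ n) := by
  induction n with
  | zero => exact fun ξ η => rfl
  | succ n ih =>
    have := ih.mul h
    rwa [← pow_succ, ← pow_succ'] at this

theorem map_act (h : E.AdjointPair T T') (ξ : E.X) (a : E.A) :
    T (E.act ξ a) = E.act (T ξ) a := by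
  apply E.ext_inner
  intro ζ
  rw [← h.symm, E.inner_act, E.inner_act, ← h.symm]

theorem norm_sq_le (h : E.AdjointPair T T') : ‖T‖ ^ 2 ≤ ‖T' * T‖ := by
  have : ‖T‖ ≤ √‖T' * T‖ := by
    refine T.opNorm_le_bound (Real.sqrt_nonneg _) fun x => ?_
    refine le_of_sq_le_sq ?_ (by positivity)
    rw [E.norm_sq, h, mul_pow, Real.sq_sqrt (norm_nonneg _)]
    calc ‖E.inner x (T' (T x))‖ ≤ ‖x‖ * ‖(T' * T) x‖ := E.norm_inner_le _ _
      _ ≤ ‖x‖ * (‖T' * T‖ * ‖x‖) := by gcongr; exact ContinuousLinearMap.le_opNorm _ _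
      _ = _ := by ring
  calc ‖T‖ ^ 2 ≤ (√‖T' * T‖) ^ 2 := by gcongr
    _ = _ := Real.sq_sqrt (norm_nonneg _)

theorem norm_le (h : E.AdjointPair T T') : ‖T‖ ≤ ‖T'‖ := by
  rcases eq_or_ne ‖T‖ 0 with h0 | h0
  · rw [h0]; exact norm_nonneg _
  have h1 := h.norm_sq_le.trans (norm_mul_le _ _)
  rw [sq] at h1
  exact le_of_mul_le_mul_right h1 (lt_of_le_of_ne (norm_nonneg _) h0.symm)

theorem norm_eq (h : E.AdjointPair T T') : ‖T‖ = ‖T'‖ := le_antisymm h.norm_le h.symm.norm_le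

theorem norm_pow_le (h : E.AdjointPair T T) (k : ℕ) : ‖T‖ ^ (2 ^ k) ≤ ‖T ^ (2 ^ k)‖ := by
  induction k with
  | zero => simp
  | succ k ih =>
    have h1 := (h.pow (2 ^ k)).norm_sq_le
    calc ‖T‖ ^ 2 ^ (k + 1) = (‖T‖ ^ 2 ^ k) ^ 2 := by rw [← pow_mul, pow_succ]
      _ ≤ ‖T ^ 2 ^ k‖ ^ 2 := by gcongr
      _ ≤ _ := by rwa [← pow_add, ← two_mul, ← pow_succ'] at h1

end AdjointPair

theorem adjointPair_theta (E : CStarCorr.{u}) (ξ η : E.X) :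
    E.AdjointPair (E.theta ξ η) (E.theta η ξ) := fun x y => by
  simp only [theta_apply]
  rw [E.inner_act_left, E.inner_act, E.star_inner]

theorem le_of_pow_le {x M C : ℝ} (hM : 0 ≤ M)
    (h : ∀ m : ℕ, x ^ (2 ^ (m + 1)) ≤ C * M ^ (2 ^ (m + 1) - 1)) : x ≤ M := by
  by_contra! hlt
  rcases hM.eq_or_lt with rfl | hM
  · have := h 0
    norm_num at this
    nlinarith
  have hq : 1 < x / M := (one_lt_div hM).2 hlt
  obtain ⟨n, hn⟩ := pow_unbounded_of_one_lt (C / M) hq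
  have h1 := h n
  have h2 : M ^ (2 ^ (n + 1)) = M ^ (2 ^ (n + 1) - 1) * M := by
    rw [← pow_succ, Nat.sub_add_cancel Nat.one_le_two_pow]
  have h3 : (x / M) ^ (2 ^ (n + 1)) ≤ C / M := by
    rw [div_pow, div_le_div_iff₀ (by positivity) hM, h2]
    nlinarith
  have h4 : (x / M) ^ n ≤ (x / M) ^ (2 ^ (n + 1)) :=
    pow_le_pow_right₀ hq.le (Nat.lt_two_pow_self.le.trans (Nat.pow_le_pow_right two_pos n.le_succ))
  linarith

variable {E F : CStarCorr.{u}} (ψX : E.X →ₗ[ℂ] F.X) (ψA : E.A →⋆ₙₐ[ℂ] F.A)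

/-- Condition (C1): `⟨ψX ξ, ψX η⟩ = ψA ⟨ξ, η⟩`. -/
def InnerCompat : Prop := ∀ ξ η : E.X, F.inner (ψX ξ) (ψX η) = ψA (E.inner ξ η)

variable {ψX ψA}

theorem InnerCompat.norm_le (h : InnerCompat ψX ψA) (ξ : E.X) : ‖ψX ξ‖ ≤ ‖ξ‖ := by
  refine le_of_sq_le_sq ?_ (norm_nonneg _)
  rw [F.norm_sq, E.norm_sq, h]
  exact NonUnitalStarAlgHom.norm_apply_le ψA _

theorem InnerCompat.map_act (h : InnerCompat ψX ψA) (ξ : E.X) (a : E.A) :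
    ψX (E.act ξ a) = F.act (ψX ξ) (ψA a) := by
  rw [← sub_eq_zero]
  apply F.inner_self_eq_zero
  simp only [map_sub, F.inner_sub_left, F.inner_act, F.inner_act_left, h _ _, E.inner_act,
    E.inner_act_left, map_mul, map_star, mul_assoc, sub_self, mul_zero]

variable (ψX) in
/-- The span of the pairs `(θ_{ξ,η}, θ_{ψX ξ, ψX η})`. -/
def plusGraph : Submodule ℂ ((E.X →L[ℂ] E.X) × (F.X →L[ℂ] F.X)) :=
  Submodule.span ℂ {p | ∃ ξ η : E.X, p = (E.theta ξ η, F.theta (ψX ξ) (ψX η))}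

theorem plusGraph_intertwine (h : InnerCompat ψX ψA) {p} (hp : p ∈ plusGraph ψX) (x : E.X) :
    p.2 (ψX x) = ψX (p.1 x) := by
  induction hp using Submodule.span_induction with
  | mem p hp =>
    obtain ⟨ξ, η, rfl⟩ := hp
    simp only [theta_apply]
    rw [h, h.map_act]
  | zero => simp
  | add p q _ _ h1 h2 => simp [h1, h2]
  | smul c p _ h1 => simp [h1]

theorem plusGraph_adjoint {p} (hp : p ∈ plusGraph ψX) :
    ∃ q ∈ plusGraph ψX, E.AdjointPair p.1 q.1 ∧ F.AdjointPair p.2 q.2 := by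
  induction hp using Submodule.span_induction with
  | mem p hp =>
    obtain ⟨ξ, η, rfl⟩ := hp
    exact ⟨_, Submodule.subset_span ⟨η, ξ, rfl⟩, E.adjointPair_theta _ _, F.adjointPair_theta _ _⟩
  | zero => exact ⟨0, Submodule.zero_mem _, fun x y => by simpa using E.inner_smul_left 0 0 y,
      fun x y => by simpa using F.inner_smul_left 0 0 y⟩
  | add p q _ _ h1 h2 =>
    obtain ⟨p', m1, a1, b1⟩ := h1
    obtain ⟨q', m2, a2, b2⟩ := h2
    exact ⟨p' + q', Submodule.add_mem _ m1 m2, a1.add a2, b1.add b2⟩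
  | smul c p _ h1 =>
    obtain ⟨p', m1, a1, b1⟩ := h1
    exact ⟨star c • p', Submodule.smul_mem _ _ m1, a1.smul c, b1.smul c⟩

theorem plusGraph_bound (h : InnerCompat ψX ψA) {p} (hp : p ∈ plusGraph ψX) :
    ∃ C : ℝ, 0 ≤ C ∧ ∀ (T : E.X →L[ℂ] E.X) (S : F.X →L[ℂ] F.X),
      (∀ y b, S (F.act y b) = F.act (S y) b) → (∀ x, S (ψX x) = ψX (T x)) →
      ‖S * p.2‖ ≤ C * ‖T‖ := by
  induction hp using Submodule.span_induction with
  | mem p hp =>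
    obtain ⟨ξ, η, rfl⟩ := hp
    refine ⟨‖ξ‖ * ‖η‖, by positivity, fun T S hS hT => ?_⟩
    have e : S * F.theta (ψX ξ) (ψX η) = F.theta (ψX (T ξ)) (ψX η) := by
      ext y
      simp only [mul_apply_eq_comp, theta_apply]
      rw [hS, hT]
    calc ‖S * F.theta (ψX ξ) (ψX η)‖ = ‖F.theta (ψX (T ξ)) (ψX η)‖ := by rw [e]
      _ ≤ ‖ψX (T ξ)‖ * ‖ψX η‖ := F.norm_theta_le _ _
      _ ≤ ‖T ξ‖ * ‖η‖ := by gcongr <;> exact h.norm_le _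
      _ ≤ (‖T‖ * ‖ξ‖) * ‖η‖ := by gcongr; exact T.le_opNorm _
      _ = _ := by ring
  | zero => exact ⟨0, le_rfl, fun T S _ _ => by simp⟩
  | add p q _ _ h1 h2 =>
    obtain ⟨C, hC, H⟩ := h1
    obtain ⟨D, hD, K⟩ := h2
    refine ⟨C + D, by positivity, fun T S hS hT => ?_⟩
    rw [Prod.snd_add, mul_add, add_mul]
    exact (norm_add_le _ _).trans (add_le_add (H T S hS hT) (K T S hS hT))
  | smul c p _ h1 =>
    obtain ⟨C, hC, H⟩ := h1
    refine ⟨‖c‖ * C, by positivity, fun T S hS hT => ?_⟩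
    rw [Prod.smul_snd, mul_smul_comm, norm_smul, mul_assoc]
    exact mul_le_mul_of_nonneg_left (H T S hS hT) (norm_nonneg _)

/-- `‖∑ θ_{ψX ξᵢ, ψX ηᵢ}‖ ≤ ‖∑ θ_{ξᵢ, ηᵢ}‖`. -/
theorem plusGraph_norm_le (h : InnerCompat ψX ψA) {p} (hp : p ∈ plusGraph ψX) :
    ‖p.2‖ ≤ ‖p.1‖ := by
  obtain ⟨q, hq, a1, a2⟩ := plusGraph_adjoint hp
  obtain ⟨C, hC, H⟩ := plusGraph_bound h hp
  have i1 := plusGraph_intertwine h hp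
  have i2 := plusGraph_intertwine h hq
  have sa : F.AdjointPair (q.2 * p.2) (q.2 * p.2) := a2.symm.mul a2
  have ipow : ∀ (m : ℕ) (x : E.X), ((q.2 * p.2) ^ m) (ψX x) = ψX (((q.1 * p.1) ^ m) x) := by
    intro m
    induction m with
    | zero => intro x; rfl
    | succ m ih =>
      intro x
      rw [pow_succ, pow_succ, mul_apply_eq_comp, mul_apply_eq_comp,
        mul_apply_eq_comp, mul_apply_eq_comp, i1, i2, ih]
  have hb : ∀ m : ℕ, ‖(q.2 * p.2) ^ (m + 1)‖ ≤ (C * ‖q.1‖) * ‖q.1 * p.1‖ ^ m := by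
    intro m
    have adj : F.AdjointPair ((q.2 * p.2) ^ m * q.2) (p.2 * (q.2 * p.2) ^ m) :=
      (sa.pow m).mul a2.symm
    have := H ((q.1 * p.1) ^ m * q.1) ((q.2 * p.2) ^ m * q.2) adj.map_act (fun x => by
      rw [mul_apply_eq_comp, mul_apply_eq_comp, i2, ipow])
    rw [mul_assoc, ← pow_succ] at this
    refine this.trans ?_
    rw [mul_assoc C]
    refine mul_le_mul_of_nonneg_left ?_ hC
    refine (norm_mul_le _ _).trans ?_
    rw [mul_comm]
    rcases m with _ | m
    · rw [pow_zero, pow_zero]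
      exact mul_le_mul_of_nonneg_left ContinuousLinearMap.norm_id_le (norm_nonneg _)
    · gcongr
      exact norm_pow_le' _ (Nat.succ_pos _)
  have hle : ‖q.2 * p.2‖ ≤ ‖q.1 * p.1‖ := by
    apply le_of_pow_le (C := C * ‖q.1‖) (norm_nonneg _)
    intro m
    refine (sa.norm_pow_le (m + 1)).trans ?_
    have := hb (2 ^ (m + 1) - 1)
    rwa [Nat.sub_add_cancel Nat.one_le_two_pow] at this
  refine le_of_sq_le_sq ?_ (norm_nonneg _)
  calc ‖p.2‖ ^ 2 ≤ ‖q.2 * p.2‖ := a2.norm_sq_le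
    _ ≤ ‖q.1 * p.1‖ := hle
    _ ≤ ‖q.1‖ * ‖p.1‖ := norm_mul_le _ _
    _ = ‖p.1‖ ^ 2 := by rw [a1.norm_eq, sq]

/-- Existence of `ψX⁺ : K(X) → K(Y)` with `ψX⁺ θ_{ξ,η} = θ_{ψX ξ, ψX η}`. -/
theorem exists_plus (h : InnerCompat ψX ψA) : ∃ P : E.compacts →L[ℂ] F.compacts,
    ∀ ξ η : E.X, P ⟨E.theta ξ η, E.theta_mem ξ η⟩ =
      ⟨F.theta (ψX ξ) (ψX η), F.theta_mem (ψX ξ) (ψX η)⟩ := by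
  let G := (plusGraph ψX).topologicalClosure
  have hG : ∀ p ∈ G, ‖p.2‖ ≤ ‖p.1‖ := by
    have hcl : IsClosed {p : (E.X →L[ℂ] E.X) × (F.X →L[ℂ] F.X) | ‖p.2‖ ≤ ‖p.1‖} :=
      isClosed_le (by fun_prop) (by fun_prop)
    exact fun p hp => closure_minimal (fun p hp => plusGraph_norm_le h hp) hcl hp
  have : CompleteSpace G := (plusGraph ψX).isClosed_topologicalClosure.completeSpace_coe
  let j : G →ₗᵢ[ℂ] (E.X →L[ℂ] E.X) :=
    { toLinearMap := (LinearMap.fst ℂ _ _).comp G.subtype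
      norm_map' := fun p => by
        have h1 := hG p.1 p.2
        change ‖p.1.1‖ = ‖p.1‖
        rw [Prod.norm_def, max_eq_left h1] }
  have hrange : E.compacts ≤ LinearMap.range j.toLinearMap := by
    refine Submodule.topologicalClosure_minimal _ ?_ ?_
    · rw [Submodule.span_le]
      rintro _ ⟨ξ, η, rfl⟩
      exact ⟨⟨(E.theta ξ η, F.theta (ψX ξ) (ψX η)),
        Submodule.le_topologicalClosure _ (Submodule.subset_span ⟨ξ, η, rfl⟩)⟩, rfl⟩
    · exact j.isometry.isClosedEmbedding.isClosed_range
  let P₀ : E.compacts →L[ℂ] (F.X →L[ℂ] F.X) :=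
    ((ContinuousLinearMap.snd ℂ _ _).comp G.subtypeL).comp
      ((j.equivRange.symm : LinearMap.range j.toLinearMap →L[ℂ] G).comp
        ((E.compacts.subtypeL).codRestrict _ fun T => hrange T.2))
  have hP₀ : ∀ (T : E.compacts) (g : G), g.1.1 = T.1 → P₀ T = g.1.2 := by
    intro T g hg
    have : j.equivRange.symm ⟨T.1, hrange T.2⟩ = g := by
      rw [LinearIsometryEquiv.symm_apply_eq]
      exact Subtype.ext hg.symm
    exact congrArg (fun g : G => g.1.2) this
  have hmem : ∀ p ∈ G, p.2 ∈ F.compacts := by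
    have hcl : IsClosed {p : (E.X →L[ℂ] E.X) × (F.X →L[ℂ] F.X) | p.2 ∈ F.compacts} :=
      (Submodule.isClosed_topologicalClosure _).preimage continuous_snd
    refine fun p hp => closure_minimal (fun p hp => ?_) hcl hp
    have hle : plusGraph ψX ≤ F.compacts.comap (LinearMap.snd ℂ _ _) := by
      refine Submodule.span_le.2 ?_
      rintro _ ⟨ξ, η, rfl⟩
      exact F.theta_mem _ _
    exact hle hp
  refine ⟨P₀.codRestrict F.compacts fun T => ?_, fun ξ η => Subtype.ext ?_⟩
  · obtain ⟨g, hg⟩ := hrange T.2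
    rw [hP₀ T g hg]
    exact hmem _ g.2
  · exact hP₀ _ ⟨(E.theta ξ η, F.theta (ψX ξ) (ψX η)),
      Submodule.le_topologicalClosure _ (Submodule.subset_span ⟨ξ, η, rfl⟩)⟩ rfl

/-- The map `ψX⁺ : K(X) → K(Y)`: the continuous linear map (unique by `compacts_ext`) with
`ψX⁺ θ_{ξ,η} = θ_{ψX ξ, ψX η}`. -/
noncomputable def plus (h : InnerCompat ψX ψA) : E.compacts →L[ℂ] F.compacts :=
  (exists_plus h).choose

theorem plus_theta (h : InnerCompat ψX ψA) (ξ η : E.X) :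
    plus h ⟨E.theta ξ η, E.theta_mem ξ η⟩ =
      ⟨F.theta (ψX ξ) (ψX η), F.theta_mem (ψX ξ) (ψX η)⟩ :=
  (exists_plus h).choose_spec ξ η

end Plus

section Morphisms

variable {E F G : CStarCorr.{u}}

/-- A pair `(ψX, ψA)`, with `ψX : X → Y` linear and `ψA : A → B` a `⋆`-homomorphism, is a morphism
of `C⋆`-correspondences `(X, A) → (Y, B)` if it satisfies (C1)–(C4). -/
structure IsMorphism (ψX : E.X →ₗ[ℂ] F.X) (ψA : E.A →⋆ₙₐ[ℂ] F.A) : Prop where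
  /-- (C1): `⟨ψX ξ, ψX η⟩ = ψA ⟨ξ, η⟩` -/
  c1 : InnerCompat ψX ψA
  /-- (C2) -/
  c2 : ∀ (a : E.A) (ξ : E.X), ψX (E.φ a ξ) = F.φ (ψA a) (ψX ξ)
  /-- (C3) -/
  c3 : ∀ a ∈ E.katsuraIdeal, ψA a ∈ F.katsuraIdeal
  /-- (C4): `φ_Y (ψA a) = ψX⁺ (φ_X a)` for `a ∈ J_X` -/
  c4 : ∀ (a : E.A) (ha : a ∈ E.katsuraIdeal),
    F.φ (ψA a) = (plus c1 ⟨E.φ a, ha.1⟩ : F.X →L[ℂ] F.X)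

theorem IsMorphism.id (E : CStarCorr.{u}) :
    IsMorphism (E := E) (F := E) LinearMap.id (NonUnitalStarAlgHom.id ℂ E.A) where
  c1 _ _ := rfl
  c2 _ _ := rfl
  c3 _ ha := ha
  c4 a ha := by
    have h : InnerCompat (E := E) (F := E) LinearMap.id (NonUnitalStarAlgHom.id ℂ E.A) :=
      fun _ _ => rfl
    have : plus h = ContinuousLinearMap.id ℂ E.compacts :=
      E.compacts_ext (plus h) (ContinuousLinearMap.id ℂ E.compacts) fun ξ η => plus_theta h ξ η
    change E.φ a = (plus h ⟨E.φ a, ha.1⟩ : E.X →L[ℂ] E.X)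
    rw [this]
    rfl

theorem IsMorphism.comp {ωX : F.X →ₗ[ℂ] G.X} {ωA : F.A →⋆ₙₐ[ℂ] G.A} {ψX : E.X →ₗ[ℂ] F.X}
    {ψA : E.A →⋆ₙₐ[ℂ] F.A} (hω : IsMorphism ωX ωA) (hψ : IsMorphism ψX ψA) :
    IsMorphism (ωX.comp ψX) (ωA.comp ψA) where
  c1 ξ η := (hω.c1 _ _).trans (congrArg ωA (hψ.c1 ξ η))
  c2 a ξ := (congrArg ωX (hψ.c2 a ξ)).trans (hω.c2 _ _)
  c3 a ha := hω.c3 _ (hψ.c3 a ha)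
  c4 a ha := by
    have h : InnerCompat (ωX.comp ψX) (ωA.comp ψA) :=
      fun ξ η => (hω.c1 _ _).trans (congrArg ωA (hψ.c1 ξ η))
    have hcomp : plus h = (plus hω.c1).comp (plus hψ.c1) := by
      refine E.compacts_ext (plus h) ((plus hω.c1).comp (plus hψ.c1)) fun ξ η => ?_
      rw [ContinuousLinearMap.comp_apply, plus_theta, plus_theta, plus_theta]
      rfl
    change G.φ (ωA (ψA a)) = (plus h ⟨E.φ a, ha.1⟩ : G.X →L[ℂ] G.X)
    rw [hcomp, ContinuousLinearMap.comp_apply, hω.c4 _ (hψ.c3 a ha)]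
    congr 2
    exact Subtype.ext (hψ.c4 a ha)

/-- Morphisms of `C⋆`-correspondences. -/
structure Hom (E F : CStarCorr.{u}) where
  /-- the linear map `ψX : X → Y` -/
  onX : E.X →ₗ[ℂ] F.X
  /-- the `⋆`-homomorphism `ψA : A → B` -/
  onA : E.A →⋆ₙₐ[ℂ] F.A
  isMorphism : IsMorphism onX onA

/-- The category of `C⋆`-correspondences. -/
instance : CategoryTheory.Category CStarCorr.{u} where
  Hom := Hom
  id E := ⟨LinearMap.id, NonUnitalStarAlgHom.id ℂ E.A, IsMorphism.id E⟩
  comp ψ ω := ⟨ω.onX.comp ψ.onX, ω.onA.comp ψ.onA, ω.isMorphism.comp ψ.isMorphism⟩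

/-- The `C⋆`-correspondence `(D, D)` of a `C⋆`-algebra `D`: both actions are given by
multiplication, and `⟨a, b⟩ = a⋆ b`. -/
noncomputable abbrev self (D : Type u) [NonUnitalCStarAlgebra D] : CStarCorr.{u} where
  A := D
  X := D
  act := LinearMap.mul ℂ D
  act_mul ξ a b := (mul_assoc ξ a b).symm
  inner a := LinearMap.mul ℂ D (star a)
  inner_act ξ η a := (mul_assoc (star ξ) η a).symm
  star_inner ξ η := by simp
  inner_self_pos ξ := ⟨ξ, rfl⟩
  norm_eq ξ := by
    rw [LinearMap.mul_apply', CStarRing.norm_star_mul_self, Real.sqrt_mul_self (norm_nonneg _)]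
  φ :=
    { toFun := fun a => ContinuousLinearMap.mul ℂ D a
      map_smul' := fun c a => map_smul _ c a
      map_zero' := map_zero _
      map_add' := fun a b => map_add _ a b
      map_mul' := fun a b => by ext x; exact mul_assoc a b x }
  φ_adjoint a ξ η := by
    change star (a * ξ) * η = star ξ * (star a * η)
    rw [star_mul, mul_assoc]

/-- A covariant representation of `(X, A)` on the `C⋆`-algebra `D` is a morphism
`(X, A) → (D, D)` of `C⋆`-correspondences. -/
def IsCovariantRep (E : CStarCorr.{u}) {D : Type u} [NonUnitalCStarAlgebra D]
    (ρX : E.X →ₗ[ℂ] D) (ρA : E.A →⋆ₙₐ[ℂ] D) : Prop :=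
  IsMorphism (E := E) (F := self D) ρX ρA

/-- Universality of a covariant representation `(πX, πA)` of `(X, A)` on `O`: it generates `O` as a
`C⋆`-algebra, and every covariant representation factors through it by a unique
`⋆`-homomorphism. -/
structure IsUniversalCovariantRep (E : CStarCorr.{u}) {O : Type u} [NonUnitalCStarAlgebra O]
    (πX : E.X →ₗ[ℂ] O) (πA : E.A →⋆ₙₐ[ℂ] O) : Prop where
  covariant : E.IsCovariantRep πX πA
  generates : (NonUnitalStarAlgebra.adjoin ℂ
    (Set.range πX ∪ Set.range πA)).topologicalClosure = ⊤
  universal : ∀ (D : Type u) [NonUnitalCStarAlgebra D] (ρX : E.X →ₗ[ℂ] D) (ρA : E.A →⋆ₙₐ[ℂ] D),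
    E.IsCovariantRep ρX ρA →
      ∃! Φ : O →⋆ₙₐ[ℂ] D, (∀ ξ, Φ (πX ξ) = ρX ξ) ∧ ∀ a, Φ (πA a) = ρA a

end Morphisms

section Katsura

/-- The covariant representations of `E = (X, A)` on `C⋆`-algebras. -/
structure CovRep (E : CStarCorr.{u}) : Type (u + 1) where
  D : Type u
  [algD : NonUnitalCStarAlgebra D]
  onX : E.X →ₗ[ℂ] D
  onA : E.A →⋆ₙₐ[ℂ] D
  isCovariantRep : E.IsCovariantRep onX onA

attribute [instance] CovRep.algD

variable (E : CStarCorr.{u})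

open scoped ENNReal

/-- The `ℓ^∞` direct sum of (the codomains of) all covariant representations. -/
abbrev BigSum : Type (u + 1) := lp (fun r : CovRep E => r.D) ∞

theorem memLp_onX (ξ : E.X) : Memℓp (fun r : CovRep E => r.onX ξ) ∞ :=
  memℓp_infty ⟨‖ξ‖, by
    rintro _ ⟨r, rfl⟩
    exact r.isCovariantRep.c1.norm_le ξ⟩

theorem memLp_onA (a : E.A) : Memℓp (fun r : CovRep E => r.onA a) ∞ :=
  memℓp_infty ⟨‖a‖, by
    rintro _ ⟨r, rfl⟩
    exact NonUnitalStarAlgHom.norm_apply_le r.onA a⟩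

/-- The direct sum of all covariant representations, on `X`. -/
noncomputable def sumX : E.X →ₗ[ℂ] E.BigSum where
  toFun ξ := ⟨fun r => r.onX ξ, E.memLp_onX ξ⟩
  map_add' ξ η := by ext r; exact map_add r.onX ξ η
  map_smul' c ξ := by ext r; exact map_smul r.onX c ξ

/-- The direct sum of all covariant representations, on `A`. -/
noncomputable def sumA : E.A →⋆ₙₐ[ℂ] E.BigSum where
  toFun a := ⟨fun r => r.onA a, E.memLp_onA a⟩
  map_smul' c a := by ext r; exact map_smul r.onA c a
  map_zero' := by ext r; exact map_zero r.onA
  map_add' a b := by ext r; exact map_add r.onA a b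
  map_mul' a b := by ext r; exact map_mul r.onA a b
  map_star' a := by ext r; exact map_star r.onA a

/-- The `C⋆`-algebra generated by the image of the direct sum of all covariant representations. -/
noncomputable def imageAlg : NonUnitalStarSubalgebra ℂ E.BigSum :=
  (NonUnitalStarAlgebra.adjoin ℂ (Set.range E.sumX ∪ Set.range E.sumA)).topologicalClosure

theorem sumX_mem (ξ : E.X) : E.sumX ξ ∈ E.imageAlg :=
  NonUnitalStarSubalgebra.le_topologicalClosure _
    (NonUnitalStarAlgebra.subset_adjoin ℂ _ (Or.inl ⟨ξ, rfl⟩))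

theorem sumA_mem (a : E.A) : E.sumA a ∈ E.imageAlg :=
  NonUnitalStarSubalgebra.le_topologicalClosure _
    (NonUnitalStarAlgebra.subset_adjoin ℂ _ (Or.inr ⟨a, rfl⟩))

noncomputable instance : NonUnitalCStarAlgebra E.imageAlg :=
  NonUnitalStarSubalgebra.nonUnitalCStarAlgebra (h_closed :=
    NonUnitalStarSubalgebra.isClosed_topologicalClosure _) E.imageAlg

instance : Small.{u} E.imageAlg := by
  let g : E.X ⊕ E.A → E.BigSum := Sum.elim E.sumX E.sumA
  let g' : (E.X ⊕ E.A) ⊕ (E.X ⊕ E.A) → E.BigSum := Sum.elim g fun x => star (g x)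
  let L := FreeNonUnitalNonAssocAlgebra.lift ℂ g'
  have hL : ∀ x, L (FreeNonUnitalNonAssocAlgebra.of ℂ x) = g' x :=
    FreeNonUnitalNonAssocAlgebra.lift_of_apply ℂ g'
  have hmem : ∀ x, g' x ∈ NonUnitalAlgHom.range L := fun x => ⟨_, hL x⟩
  have hadj : ∀ y ∈ NonUnitalStarAlgebra.adjoin ℂ (Set.range E.sumX ∪ Set.range E.sumA),
      y ∈ Set.range L := by
    intro y hy
    refine (NonUnitalAlgebra.adjoin_le (S := NonUnitalAlgHom.range L) ?_ : _) hy
    rintro z ((⟨ξ, rfl⟩ | ⟨a, rfl⟩) | hz)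
    · exact hmem (Sum.inl (Sum.inl ξ))
    · exact hmem (Sum.inl (Sum.inr a))
    · rw [Set.mem_star] at hz
      rcases hz with ⟨ξ, hξ⟩ | ⟨a, ha⟩
      · have := hmem (Sum.inr (Sum.inl ξ))
        rwa [show g' (Sum.inr (Sum.inl ξ)) = z from (congrArg star hξ).trans (star_star z)] at this
      · have := hmem (Sum.inr (Sum.inr a))
        rwa [show g' (Sum.inr (Sum.inr a)) = z from (congrArg star ha).trans (star_star z)] at this
  let lim : (ℕ → FreeNonUnitalNonAssocAlgebra ℂ ((E.X ⊕ E.A) ⊕ (E.X ⊕ E.A))) → E.BigSum :=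
    fun s => Filter.limUnder Filter.atTop fun n => L (s n)
  have hsub : (E.imageAlg : Set E.BigSum) ⊆ Set.range lim := by
    intro y hy
    obtain ⟨s, hs, hlim⟩ := mem_closure_iff_seq_limit.1 hy
    choose t ht using fun n => hadj _ (hs n)
    refine ⟨t, ?_⟩
    simp only [lim, ht]
    exact hlim.limUnder_eq
  exact small_subset hsub

/-- The Katsura algebra `O_X` of `E = (X, A)`: the `C⋆`-algebra generated by the image of `(X, A)`
in the direct sum of all its covariant representations (carried by a copy in `Type u`). -/
def KatsuraAlgebra : Type u := Shrink.{u} E.imageAlg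

namespace KatsuraAlgebra

/-- The bijection of `O_X` with the generated algebra, which transports the structure. -/
noncomputable def equiv : E.KatsuraAlgebra ≃ E.imageAlg := (equivShrink E.imageAlg).symm

noncomputable instance : NonUnitalRing E.KatsuraAlgebra := (equiv E).nonUnitalRing

noncomputable instance : Module ℂ E.KatsuraAlgebra := (equiv E).module ℂ

noncomputable instance : Star E.KatsuraAlgebra := ⟨fun x => (equiv E).symm (star (equiv E x))⟩

theorem star_def (x : E.KatsuraAlgebra) : star x = (equiv E).symm (star (equiv E x)) := rfl

noncomputable instance : StarRing E.KatsuraAlgebra where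
  star_involutive x := by simp only [star_def, Equiv.apply_symm_apply, star_star,
    Equiv.symm_apply_apply]
  star_mul x y := by simp only [star_def, Equiv.mul_def, Equiv.apply_symm_apply, star_mul]
  star_add x y := by simp only [star_def, Equiv.add_def, Equiv.apply_symm_apply, star_add]

/-- `equiv` as a `⋆`-homomorphism. -/
noncomputable def toImage : E.KatsuraAlgebra →⋆ₙₐ[ℂ] E.imageAlg where
  toFun := equiv E
  map_smul' c x := by simp [Equiv.smul_def]
  map_zero' := by simp [Equiv.zero_def]
  map_add' x y := by simp [Equiv.add_def]
  map_mul' x y := by simp [Equiv.mul_def]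
  map_star' x := by simp [star_def]

noncomputable instance : NonUnitalNormedRing E.KatsuraAlgebra :=
  NonUnitalNormedRing.induced _ _ (toImage E) (equiv E).injective

theorem norm_def (x : E.KatsuraAlgebra) : ‖x‖ = ‖toImage E x‖ := rfl

theorem isometry_toImage : Isometry (toImage E) :=
  AddMonoidHomClass.isometry_of_norm _ fun _ => rfl

noncomputable instance : NonUnitalCStarAlgebra E.KatsuraAlgebra where
  toCompleteSpace := by
    have h : CompleteSpace E.KatsuraAlgebra :=
      ((isometry_toImage E).isUniformInducing.completeSpace_congr (equiv E).surjective).2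
        inferInstance
    exact h
  norm_mul_self_le x := by
    rw [norm_def, norm_def, map_mul, map_star, CStarRing.norm_star_mul_self]
  norm_smul_le c x := by
    rw [norm_def, norm_def, map_smul, norm_smul]
  smul_assoc c x y := (equiv E).injective (by
    change toImage E ((c • x) * y) = toImage E (c • (x * y))
    simp only [map_smul, map_mul, smul_mul_assoc])
  smul_comm c x y := (equiv E).injective (by
    change toImage E (c • (x * y)) = toImage E (x * (c • y))
    simp only [map_smul, map_mul, mul_smul_comm])
  star_smul c x := (equiv E).injective (by
    change toImage E (star (c • x)) = toImage E (star c • star x)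
    simp only [map_smul, map_star, star_smul])

end KatsuraAlgebra

open KatsuraAlgebra in
/-- The map `πX : X → O_X`. -/
noncomputable def piX : E.X →ₗ[ℂ] E.KatsuraAlgebra where
  toFun ξ := (equiv E).symm ⟨E.sumX ξ, E.sumX_mem ξ⟩
  map_add' ξ η := (equiv E).injective (by
    simp only [Equiv.add_def, Equiv.apply_symm_apply]
    exact Subtype.ext (map_add E.sumX ξ η))
  map_smul' c ξ := (equiv E).injective (by
    simp only [Equiv.smul_def, Equiv.apply_symm_apply]
    exact Subtype.ext (map_smul E.sumX c ξ))

open KatsuraAlgebra in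
/-- The map `πA : A → O_X`. -/
noncomputable def piA : E.A →⋆ₙₐ[ℂ] E.KatsuraAlgebra where
  toFun a := (equiv E).symm ⟨E.sumA a, E.sumA_mem a⟩
  map_smul' c a := (equiv E).injective (by
    simp only [Equiv.smul_def, Equiv.apply_symm_apply]
    exact Subtype.ext (map_smul E.sumA c a))
  map_zero' := (equiv E).injective (by
    simp only [Equiv.zero_def, Equiv.apply_symm_apply]
    exact Subtype.ext (map_zero E.sumA))
  map_add' a b := (equiv E).injective (by
    simp only [Equiv.add_def, Equiv.apply_symm_apply]
    exact Subtype.ext (map_add E.sumA a b))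
  map_mul' a b := (equiv E).injective (by
    simp only [Equiv.mul_def, Equiv.apply_symm_apply]
    exact Subtype.ext (map_mul E.sumA a b))
  map_star' a := (equiv E).injective (by
    simp only [star_def, Equiv.apply_symm_apply]
    exact Subtype.ext (map_star E.sumA a))

variable {E}

/-- `Ψ : O_X → O_Y` extends the morphism `ψ = (ψX, ψA) : (X, A) → (Y, B)`: it intertwines the
universal covariant representations, `Ψ ∘ πX = πY ∘ ψX` and `Ψ ∘ πA = πB ∘ ψA`. -/
def Extends {F : CStarCorr.{u}} (ψ : E ⟶ F) (Ψ : E.KatsuraAlgebra →⋆ₙₐ[ℂ] F.KatsuraAlgebra) :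
    Prop :=
  (∀ ξ : E.X, Ψ (E.piX ξ) = F.piX (ψ.onX ξ)) ∧ ∀ a : E.A, Ψ (E.piA a) = F.piA (ψ.onA a)

end Katsura

end CStarCorr

/-- The (not necessarily unital) `C⋆`-algebras, as the objects of a category. -/
structure CStarAlgCat : Type (u + 1) where
  /-- the underlying type -/
  carrier : Type u
  [alg : NonUnitalCStarAlgebra carrier]

namespace CStarAlgCat

attribute [instance] alg

/-- The category of `C⋆`-algebras and `⋆`-homomorphisms. -/
instance : CategoryTheory.Category CStarAlgCat.{u} where
  Hom A B := A.carrier →⋆ₙₐ[ℂ] B.carrier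
  id A := NonUnitalStarAlgHom.id ℂ A.carrier
  comp f g := g.comp f

/-- The `⋆`-homomorphism underlying a morphism of the category of `C⋆`-algebras. -/
def Hom.toStarHom {A B : CStarAlgCat.{u}} (f : A ⟶ B) : A.carrier →⋆ₙₐ[ℂ] B.carrier := f

end CStarAlgCat

/-- The Katsura algebra `O_X` as an object of the category of `C⋆`-algebras. -/
noncomputable def CStarCorr.katsuraObj (E : CStarCorr.{u}) : CStarAlgCat.{u} :=
  ⟨E.KatsuraAlgebra⟩

/-! That `ψX⁺` respects identities and composition gives the category. The substance is that the
direct sum `π` of all covariant representations is itself covariant; (C1) and (C2) hold because they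
hold in every summand, but (C3) and (C4) involve compact operators and need an argument.

For the correspondence `(D, D)`, left multiplication is an isometry of `D` onto `K(D)`
(`self_compacts`), so `J_D = D` and (C3) is automatic. Under this identification, `f⁺` for a
`⋆`-homomorphism `f` is `f` itself (`plus_self`). Given `a ∈ J_X`, the operator `π⁺(φ a)` is
therefore multiplication by some `t ∈ O_X`, and (C4) says `πA a = t`. The coordinate maps `r.lift :
O_X → D` separate points (`ext_lift`), and functoriality of `⁺` shows that multiplication by `r.lift
t` is `ρX⁺(φ a)`. By (C4) for `r` this is multiplication by `ρA a`, so `t` and `πA a` agree in each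
coordinate (`isCovariantRep_pi`).

Universality is then formal: a covariant representation is one of the summands, so it factors
through its coordinate map, uniquely because `O_X` is generated by the image of `π`. Composing a
morphism with the universal representation of its target gives a covariant representation of the
source, whence `Ψ`; uniqueness of `Ψ` yields functoriality and the uniqueness of the functor. -/

namespace CStarCorr

/-! ### Compact operators on the correspondence `(D, D)` -/

section SelfCorrespondence

variable {D D' : Type u} [NonUnitalCStarAlgebra D] [NonUnitalCStarAlgebra D']

theorem self_theta (a b : D) :
    (self D).theta a b = ContinuousLinearMap.mul ℂ D (a * star b) := by
  ext x
  exact (mul_assoc a (star b) x).symm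

/-- Every element is a combination of positive ones. Since `θ_{b⋆,b⋆}` is multiplication by `b⋆ b`,
all multiplications are thus finite sums of rank-one operators, with no approximate unit needed. -/
theorem span_star_mul_self (D : Type u) [NonUnitalCStarAlgebra D] :
    Submodule.span ℂ {x : D | ∃ b : D, x = star b * b} = ⊤ := by
  let _ : PartialOrder D := CStarAlgebra.spectralOrder D
  have : StarOrderedRing D := CStarAlgebra.spectralOrderedRing D
  rw [eq_top_iff, ← CStarAlgebra.span_nonneg, Submodule.span_le]
  intro x hx
  exact Submodule.subset_span (CStarAlgebra.nonneg_iff_eq_star_mul_self.1 hx)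

/-- The isometric image of the complete space `D` is closed, so it contains the closure of the span
of the `θ_{a,b}`, which are multiplications by `a b⋆`. -/
theorem self_compacts :
    (self D).compacts = LinearMap.range (ContinuousLinearMap.mulₗᵢ ℂ D).toLinearMap := by
  apply le_antisymm
  · refine Submodule.topologicalClosure_minimal _ ?_
      (ContinuousLinearMap.mulₗᵢ ℂ D).isometry.isClosedEmbedding.isClosed_range
    rw [Submodule.span_le]
    rintro _ ⟨a, b, rfl⟩
    exact ⟨a * star b, (self_theta a b).symm⟩
  · rw [LinearMap.range_eq_map, ← span_star_mul_self, Submodule.map_span, Submodule.span_le]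
    rintro _ ⟨_, ⟨b, rfl⟩, rfl⟩
    have h := (self D).theta_mem (star b) (star b)
    rw [self_theta, star_star] at h
    exact h

theorem mul_mem_compacts (a : D) : ContinuousLinearMap.mul ℂ D a ∈ (self D).compacts := by
  rw [self_compacts]
  exact ⟨a, rfl⟩

theorem mul_left_injective : Function.Injective (ContinuousLinearMap.mul ℂ D) :=
  (ContinuousLinearMap.mulₗᵢ ℂ D).injective

/-- The left action of `D` on itself is injective and by compact operators, so both conditions are
vacuous and (C3) is free for representations. -/
theorem mem_katsuraIdeal_self (a : D) : a ∈ (self D).katsuraIdeal := by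
  refine ⟨mul_mem_compacts a, fun b hb => ?_⟩
  have : b = 0 := mul_left_injective (hb.trans (map_zero _).symm)
  rw [this, mul_zero]

/-- Left multiplication, as a continuous linear map into the compact operators. -/
noncomputable def mulCompacts (D : Type u) [NonUnitalCStarAlgebra D] :
    D →L[ℂ] (self D).compacts :=
  (ContinuousLinearMap.mul ℂ D).codRestrict (self D).compacts mul_mem_compacts

theorem innerCompat_self (f : D →⋆ₙₐ[ℂ] D') :
    InnerCompat (E := self D) (F := self D') (f : D →ₗ[ℂ] D') f := fun a b => by
  change star (f a) * f b = f (star a * b)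
  rw [map_mul, map_star]

/-- Under `K(D) ≅ D` and `K(D') ≅ D'`, the map `f⁺` becomes `f`. -/
theorem plus_self (f : D →⋆ₙₐ[ℂ] D') (t : D) :
    plus (innerCompat_self f) ⟨ContinuousLinearMap.mul ℂ D t, mul_mem_compacts t⟩ =
      ⟨ContinuousLinearMap.mul ℂ D' (f t), mul_mem_compacts (f t)⟩ := by
  -- Both sides are linear in `t`, and the elements `b⋆ b` span algebraically, not just densely; on
  -- them the value is prescribed by `plus_theta`.
  have key : (plus (innerCompat_self f)).toLinearMap.comp (mulCompacts D).toLinearMap =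
      (mulCompacts D').toLinearMap.comp (f : D →ₗ[ℂ] D') := by
    refine LinearMap.ext_on_range (v := fun b : D => star b * b) ?_ fun b => ?_
    · rw [← span_star_mul_self D]
      congr 1
      ext x
      exact ⟨fun ⟨b, hb⟩ => ⟨b, hb.symm⟩, fun ⟨b, hb⟩ => ⟨b, hb.symm⟩⟩
    · have h1 := plus_theta (innerCompat_self f) (star b) (star b)
      have e : (mulCompacts D (star b * b)) =
          ⟨(self D).theta (star b) (star b), (self D).theta_mem _ _⟩ := by
        refine Subtype.ext (Eq.symm ((self_theta (star b) (star b)).trans ?_))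
        rw [star_star]
        rfl
      change plus (innerCompat_self f) (mulCompacts D (star b * b)) =
        mulCompacts D' (f (star b * b))
      rw [e, h1]
      refine Subtype.ext ((self_theta (f (star b)) (f (star b))).trans ?_)
      change ContinuousLinearMap.mul ℂ D' (f (star b) * star (f (star b))) =
        ContinuousLinearMap.mul ℂ D' (f (star b * b))
      rw [map_mul f, ← map_star, star_star]
  exact LinearMap.congr_fun key t

end SelfCorrespondence

/-! ### Functoriality of `ψX⁺` -/

section Comp

variable {E F G : CStarCorr.{u}}

theorem InnerCompat.comp {ωX : F.X →ₗ[ℂ] G.X} {ωA : F.A →⋆ₙₐ[ℂ] G.A} {ψX : E.X →ₗ[ℂ] F.X}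
    {ψA : E.A →⋆ₙₐ[ℂ] F.A} (hω : InnerCompat ωX ωA) (hψ : InnerCompat ψX ψA) :
    InnerCompat (ωX.comp ψX) (ωA.comp ψA) :=
  fun ξ η => (hω _ _).trans (congrArg ωA (hψ ξ η))

/-- Only (C1) is assumed, because this is applied with `ψ = π` before `π` is known to be a morphism.
-/
theorem plus_comp {ωX : F.X →ₗ[ℂ] G.X} {ωA : F.A →⋆ₙₐ[ℂ] G.A} {ψX : E.X →ₗ[ℂ] F.X}
    {ψA : E.A →⋆ₙₐ[ℂ] F.A} (hω : InnerCompat ωX ωA) (hψ : InnerCompat ψX ψA)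
    (T : E.compacts) : plus (hω.comp hψ) T = plus hω (plus hψ T) := by
  have : plus (hω.comp hψ) = (plus hω).comp (plus hψ) := by
    refine E.compacts_ext _ _ fun ξ η => ?_
    rw [ContinuousLinearMap.comp_apply, plus_theta, plus_theta, plus_theta]
    rfl
  rw [this]
  rfl

/-- The defining values on the `θ_{ξ,η}` involve only the module map; the algebra maps may differ.
-/
theorem plus_congr {ψX ωX : E.X →ₗ[ℂ] F.X} {ψA ωA : E.A →⋆ₙₐ[ℂ] F.A}
    (hψ : InnerCompat ψX ψA) (hω : InnerCompat ωX ωA) (e : ψX = ωX) : plus hψ = plus hω := by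
  subst e
  exact E.compacts_ext _ _ fun ξ η => by rw [plus_theta, plus_theta]

end Comp

/-! ### The universal covariant representation -/

section Universal

variable (E : CStarCorr.{u})

open KatsuraAlgebra

/-- The inclusion of `O_X` into the direct sum of all covariant representations. -/
noncomputable def toBigSum : E.KatsuraAlgebra →⋆ₙₐ[ℂ] E.BigSum :=
  (NonUnitalStarSubalgebraClass.subtype E.imageAlg).comp (toImage E)

theorem toBigSum_isometry : Isometry E.toBigSum :=
  isometry_subtype_coe.comp (isometry_toImage E)

theorem toBigSum_mem (x : E.KatsuraAlgebra) : E.toBigSum x ∈ E.imageAlg := (toImage E x).2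

theorem toBigSum_piX (ξ : E.X) : E.toBigSum (E.piX ξ) = E.sumX ξ :=
  congrArg Subtype.val ((KatsuraAlgebra.equiv E).apply_symm_apply ⟨E.sumX ξ, E.sumX_mem ξ⟩)

theorem toBigSum_piA (a : E.A) : E.toBigSum (E.piA a) = E.sumA a :=
  congrArg Subtype.val ((KatsuraAlgebra.equiv E).apply_symm_apply ⟨E.sumA a, E.sumA_mem a⟩)

variable {E} in
/-- The `⋆`-homomorphism from `O_X` induced by a covariant representation. -/
noncomputable def CovRep.lift (r : CovRep E) : E.KatsuraAlgebra →⋆ₙₐ[ℂ] r.D where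
  toFun x := E.toBigSum x r
  map_smul' c x := by rw [map_smul]; rfl
  map_zero' := by rw [map_zero]; rfl
  map_add' x y := by rw [map_add]; rfl
  map_mul' x y := by rw [map_mul]; rfl
  map_star' x := by rw [map_star]; rfl

variable {E} in
theorem CovRep.lift_piX (r : CovRep E) (ξ : E.X) : r.lift (E.piX ξ) = r.onX ξ :=
  congrArg (fun f : E.BigSum => f r) (E.toBigSum_piX ξ)

variable {E} in
theorem CovRep.lift_piA (r : CovRep E) (a : E.A) : r.lift (E.piA a) = r.onA a :=
  congrArg (fun f : E.BigSum => f r) (E.toBigSum_piA a)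

/-- The lifts are the coordinates of an embedding into the direct sum, so identities in `O_X` can be
checked in one representation at a time. -/
theorem ext_lift {x y : E.KatsuraAlgebra} (h : ∀ r : CovRep E, r.lift x = r.lift y) : x = y :=
  E.toBigSum_isometry.injective (lp.ext (funext h))

theorem innerCompat_pi : InnerCompat (E := E) (F := self E.KatsuraAlgebra) E.piX E.piA := by
  intro ξ η
  refine E.ext_lift fun r => ?_
  change r.lift (star (E.piX ξ) * E.piX η) = r.lift (E.piA (E.inner ξ η))
  rw [map_mul, map_star, r.lift_piX, r.lift_piX, r.lift_piA]
  exact r.isCovariantRep.c1 ξ η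

theorem isCovariantRep_pi : E.IsCovariantRep E.piX E.piA where
  c1 := E.innerCompat_pi
  c2 a ξ := by
    refine E.ext_lift fun r => ?_
    change r.lift (E.piX (E.φ a ξ)) = r.lift (E.piA a * E.piX ξ)
    rw [map_mul, r.lift_piX, r.lift_piX, r.lift_piA]
    exact r.isCovariantRep.c2 a ξ
  c3 a _ := mem_katsuraIdeal_self (E.piA a)
  c4 a ha := by
    -- `π⁺(φ a)` is compact on `O_X`, hence multiplication by some `t`; it remains to prove `πA a =
    -- t`.
    obtain ⟨t, ht⟩ := self_compacts.le (plus E.innerCompat_pi ⟨E.φ a, ha.1⟩).2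
    refine Eq.trans (congrArg (ContinuousLinearMap.mul ℂ E.KatsuraAlgebra) ?_) ht
    refine E.ext_lift fun r => mul_left_injective ?_
    have e : plus E.innerCompat_pi ⟨E.φ a, ha.1⟩ =
        ⟨ContinuousLinearMap.mul ℂ E.KatsuraAlgebra t, mul_mem_compacts t⟩ :=
      Subtype.ext ht.symm
    -- Compute `(r.lift ∘ π)⁺(φ a)` in two ways: it is multiplication by `r.lift t`, and, as `r.lift
    -- ∘ πX = r.onX`, it is `r.onX⁺(φ a)`, to which (C4) for `r` applies.
    have h1 := plus_comp (innerCompat_self r.lift) E.innerCompat_pi ⟨E.φ a, ha.1⟩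
    rw [e, plus_self] at h1
    rw [plus_congr _ r.isCovariantRep.c1 (LinearMap.ext r.lift_piX)] at h1
    rw [r.lift_piA]
    exact (r.isCovariantRep.c4 a ha).trans (congrArg Subtype.val h1)

/-- Generation holds by construction inside the direct sum; it is pulled back along the isometric
inclusion of `O_X`. -/
theorem pi_generates : (NonUnitalStarAlgebra.adjoin ℂ
    (Set.range E.piX ∪ Set.range E.piA)).topologicalClosure = ⊤ := by
  let S : NonUnitalStarSubalgebra ℂ E.KatsuraAlgebra :=
    (NonUnitalStarAlgebra.adjoin ℂ (Set.range E.piX ∪ Set.range E.piA)).topologicalClosure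
  have hS : Set.range E.piX ∪ Set.range E.piA ⊆ S := fun x hx =>
    NonUnitalStarSubalgebra.le_topologicalClosure _ (NonUnitalStarAlgebra.subset_adjoin ℂ _ hx)
  have hle : E.imageAlg ≤ S.map E.toBigSum := by
    refine NonUnitalStarSubalgebra.topologicalClosure_minimal _
      (NonUnitalStarAlgebra.adjoin_le ?_) ?_
    · rintro _ (⟨ξ, rfl⟩ | ⟨a, rfl⟩)
      · exact ⟨E.piX ξ, hS (Or.inl ⟨ξ, rfl⟩), E.toBigSum_piX ξ⟩
      · exact ⟨E.piA a, hS (Or.inr ⟨a, rfl⟩), E.toBigSum_piA a⟩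
    -- Completeness of `O_X` makes the isometry a closed map, so the image of the closed subalgebra
    -- `S` is closed.
    · exact E.toBigSum_isometry.isClosedEmbedding.isClosedMap _
        (NonUnitalStarSubalgebra.isClosed_topologicalClosure _)
  refine eq_top_iff.2 fun x _ => ?_
  obtain ⟨y, hy, hyx⟩ := hle (E.toBigSum_mem x)
  rwa [← E.toBigSum_isometry.injective hyx]

theorem continuous_starHom {D D' : Type u} [NonUnitalCStarAlgebra D] [NonUnitalCStarAlgebra D']
    (f : D →⋆ₙₐ[ℂ] D') : Continuous f :=
  AddMonoidHomClass.continuous_of_bound f 1 fun x => by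
    rw [one_mul]
    exact NonUnitalStarAlgHom.norm_apply_le f x

/-- Two `⋆`-homomorphisms agree on a `⋆`-subalgebra, closed since both are contractive; containing
the generators, it is everything. -/
theorem starHom_ext_pi {D : Type u} [NonUnitalCStarAlgebra D] (f g : E.KatsuraAlgebra →⋆ₙₐ[ℂ] D)
    (hX : ∀ ξ, f (E.piX ξ) = g (E.piX ξ)) (hA : ∀ a, f (E.piA a) = g (E.piA a)) : f = g := by
  have hle : (NonUnitalStarAlgebra.adjoin ℂ
      (Set.range E.piX ∪ Set.range E.piA)).topologicalClosure ≤
      NonUnitalStarAlgHom.equalizer f g := by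
    refine NonUnitalStarSubalgebra.topologicalClosure_minimal _
      (NonUnitalStarAlgebra.adjoin_le ?_) ?_
    · rintro _ (⟨ξ, rfl⟩ | ⟨a, rfl⟩)
      · exact hX ξ
      · exact hA a
    · exact isClosed_eq (continuous_starHom f) (continuous_starHom g)
  rw [pi_generates] at hle
  exact NonUnitalStarAlgHom.ext fun x => hle (Set.mem_univ x)

theorem isUniversalCovariantRep_pi : E.IsUniversalCovariantRep E.piX E.piA where
  covariant := E.isCovariantRep_pi
  generates := E.pi_generates
  universal D _ ρX ρA h := by
    -- The given representation is itself an index of the direct sum, so projection to its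
    -- coordinate is the factorization.
    let r : CovRep E := ⟨D, ρX, ρA, h⟩
    refine ⟨r.lift, ⟨r.lift_piX, r.lift_piA⟩, fun f hf => ?_⟩
    exact E.starHom_ext_pi f r.lift (fun ξ => (hf.1 ξ).trans (r.lift_piX ξ).symm)
      fun a => (hf.2 a).trans (r.lift_piA a).symm

end Universal

/-! ### The functor `(X, A) ↦ O_X` -/

section Functor

variable {E F G : CStarCorr.{u}}

/-- `(πY ∘ ψX, πB ∘ ψA)` is a covariant representation of the source, being a composite of
morphisms; the universal property does the rest. -/
theorem existsUnique_extends (ψ : E ⟶ F) :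
    ∃! Ψ : E.KatsuraAlgebra →⋆ₙₐ[ℂ] F.KatsuraAlgebra, Extends ψ Ψ :=
  E.isUniversalCovariantRep_pi.universal F.KatsuraAlgebra (F.piX.comp ψ.onX) (F.piA.comp ψ.onA)
    (IsMorphism.comp F.isCovariantRep_pi ψ.isMorphism)

/-- The `⋆`-homomorphism `O_X → O_Y` extending a morphism `(X, A) → (Y, B)`. -/
noncomputable def katsuraMap (ψ : E ⟶ F) : E.KatsuraAlgebra →⋆ₙₐ[ℂ] F.KatsuraAlgebra :=
  (existsUnique_extends ψ).choose

theorem extends_katsuraMap (ψ : E ⟶ F) : Extends ψ (katsuraMap ψ) :=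
  (existsUnique_extends ψ).choose_spec.1

theorem Extends.unique {ψ : E ⟶ F} {Ψ Ψ' : E.KatsuraAlgebra →⋆ₙₐ[ℂ] F.KatsuraAlgebra}
    (h : Extends ψ Ψ) (h' : Extends ψ Ψ') : Ψ = Ψ' :=
  (existsUnique_extends ψ).unique h h'

theorem Extends.id (E : CStarCorr.{u}) :
    Extends (CategoryTheory.CategoryStruct.id E) (NonUnitalStarAlgHom.id ℂ E.KatsuraAlgebra) :=
  ⟨fun _ => rfl, fun _ => rfl⟩

theorem Extends.comp {ψ : E ⟶ F} {ω : F ⟶ G} {Ψ : E.KatsuraAlgebra →⋆ₙₐ[ℂ] F.KatsuraAlgebra}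
    {Ω : F.KatsuraAlgebra →⋆ₙₐ[ℂ] G.KatsuraAlgebra} (hψ : Extends ψ Ψ) (hω : Extends ω Ω) :
    Extends (CategoryTheory.CategoryStruct.comp ψ ω) (Ω.comp Ψ) :=
  ⟨fun ξ => (congrArg Ω (hψ.1 ξ)).trans (hω.1 _), fun a => (congrArg Ω (hψ.2 a)).trans (hω.2 _)⟩

/-- The functor `(X, A) ↦ O_X`. -/
noncomputable def katsuraFunctor : CategoryTheory.Functor CStarCorr.{u} CStarAlgCat.{u} where
  obj E := E.katsuraObj
  map ψ := katsuraMap ψ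
  map_id E := (extends_katsuraMap _).unique (Extends.id E)
  map_comp ψ ω := (extends_katsuraMap _).unique ((extends_katsuraMap ψ).comp (extends_katsuraMap ω))

open CategoryTheory in
-- Moves the transports to the other side, into the shape that `CategoryTheory.Functor.ext` expects.
theorem eq_eqToHom_conj {C : Type*} [Category C] {X X' Y Y' : C} (hX : X = X') (hY : Y = Y')
    {f : X ⟶ Y} {g : X' ⟶ Y'} (h : eqToHom hX.symm ≫ f ≫ eqToHom hY = g) :
    f = eqToHom hX ≫ g ≫ eqToHom hY.symm := by
  subst hX hY h
  simp

end Functor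

end CStarCorr

theorem mainTheorem8 :
    -- morphisms of `C⋆`-correspondences contain the identities and are closed under composition
    (∀ E : CStarCorr.{u},
      CStarCorr.IsMorphism (E := E) (F := E) LinearMap.id (NonUnitalStarAlgHom.id ℂ E.A)) ∧
    (∀ (E F G : CStarCorr.{u}) (ψX : E.X →ₗ[ℂ] F.X) (ψA : E.A →⋆ₙₐ[ℂ] F.A)
      (ωX : F.X →ₗ[ℂ] G.X) (ωA : F.A →⋆ₙₐ[ℂ] G.A),
      CStarCorr.IsMorphism ψX ψA → CStarCorr.IsMorphism ωX ωA →
        CStarCorr.IsMorphism (ωX.comp ψX) (ωA.comp ψA)) ∧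
    -- `(πX, πA)` is a universal covariant representation of `(X, A)` on `O_X`
    (∀ E : CStarCorr.{u}, E.IsUniversalCovariantRep E.piX E.piA) ∧
    -- every morphism extends uniquely to a `⋆`-homomorphism `O_X → O_Y`
    (∀ (E F : CStarCorr.{u}) (ψ : E ⟶ F),
      ∃! Ψ : E.KatsuraAlgebra →⋆ₙₐ[ℂ] F.KatsuraAlgebra, CStarCorr.Extends ψ Ψ) ∧
    -- these extensions are the morphism part of a (unique) functor with `(X, A) ↦ O_X`
    (∃! Φ : CategoryTheory.Functor CStarCorr.{u} CStarAlgCat.{u},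
      ∃ hobj : ∀ E : CStarCorr.{u}, Φ.obj E = E.katsuraObj,
        ∀ (E F : CStarCorr.{u}) (ψ : E ⟶ F),
          CStarCorr.Extends ψ (CStarAlgCat.Hom.toStarHom
            (CategoryTheory.CategoryStruct.comp (CategoryTheory.eqToHom (hobj E).symm)
              (CategoryTheory.CategoryStruct.comp (Φ.map ψ)
                (CategoryTheory.eqToHom (hobj F)))))) := by
  refine ⟨CStarCorr.IsMorphism.id, fun _ _ _ _ _ _ _ hψ hω => hω.comp hψ,
    CStarCorr.isUniversalCovariantRep_pi, fun _ _ => CStarCorr.existsUnique_extends,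
    CStarCorr.katsuraFunctor, ⟨fun _ => rfl, fun _ _ ψ => CStarCorr.extends_katsuraMap ψ⟩, ?_⟩
  rintro Φ ⟨hobj, hmap⟩
  -- After transport along the equalities of objects, `Φ.map ψ` extends `ψ`, so it is the unique
  -- such extension, `katsuraMap ψ`.
  exact CategoryTheory.Functor.ext hobj fun E F ψ => CStarCorr.eq_eqToHom_conj (hobj E) (hobj F)
    ((hmap E F ψ).unique (CStarCorr.extends_katsuraMap ψ))
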